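/- Let $d\ge 3$, and let $\mu_1,\mu_2$ be probability measures on $\mathbf{Z}^d$, each with mean $0$ and with bounded support that is of full dimension, i.e. the support spans $\mathbf{R}^d$. Let $(\mathcal{F}_t)_{t\ge 0}$ be a filtration on a probability space and let $(X_t)_{t\ge 0}$ be an $(\mathcal{F}_t)$-adapted process with values in $\mathbf{Z}^d$ such that, for every $t\ge 0$, almost surely the conditional law of the step $X_{t+1}-X_t$ given $\mathcal{F}_t$ is either $\mu_1$ or $\mu_2$ (which of the two may depend on $t$ and on the sample point). Then $(X_t)$ is transient: almost surely every site of $\mathbf{Z}^d$ is visited only finitely many times, equivalently $|X_t|\to\infty$ almost surely. -/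

import Mathlib

open MeasureTheory

/-- The support of a measure on the lattice `ℤ^d`: the set of its atoms. -/
def latticeSupport {d : ℕ} (μ : Measure (Fin d → ℤ)) : Set (Fin d → ℤ) :=
  {z | μ {z} ≠ 0}

/-- The coordinatewise inclusion of `ℤ^d` in `ℝ^d`. -/
def latticeToReal {d : ℕ} (z : Fin d → ℤ) : Fin d → ℝ := fun i => (z i : ℝ)

/-- A step distribution on `ℤ^d`: a probability measure with bounded support, mean zero, and whose
support spans `ℝ^d`. (For a mean-zero measure the affine span of the support contains the origin,
so the linear span and the affine span agree.) -/
structure IsStepLaw {d : ℕ} (μ : Measure (Fin d → ℤ)) : Prop where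
  isProbabilityMeasure : IsProbabilityMeasure μ
  bounded_support : Bornology.IsBounded (latticeSupport μ)
  mean_zero : ∫ z, latticeToReal z ∂μ = 0
  full_dimension : Submodule.span ℝ (latticeToReal '' latticeSupport μ) = ⊤

/-- At the sample point `ω`, the conditional law under `P` of the step `X (t+1) - X t` given the
`σ`-algebra `m` is `μ`. As `ℤ^d` is countable, a law on it is determined by the point masses. -/
def StepHasCondLawAt {d : ℕ} {Ω : Type*} {mΩ : MeasurableSpace Ω} (P : Measure Ω)
    (m : MeasurableSpace Ω) (X : ℕ → Ω → (Fin d → ℤ)) (t : ℕ) (μ : Measure (Fin d → ℤ))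
    (ω : Ω) : Prop :=
  ∀ z : Fin d → ℤ,
    (P[({ω' | X (t + 1) ω' - X t ω' = z} : Set Ω).indicator (fun _ => (1 : ℝ)) | m]) ω = μ.real {z}

/-- A process on `ℤ^d` is transient if almost surely every site is visited only finitely often.
(Bounded subsets of `ℤ^d` are finite, so this says that `|X t|` tends to infinity.) -/
def IsTransientProcess {d : ℕ} {Ω : Type*} {mΩ : MeasurableSpace Ω} (P : Measure Ω)
    (X : ℕ → Ω → (Fin d → ℤ)) : Prop :=
  ∀ᵐ ω ∂P, ∀ x : Fin d → ℤ, {t : ℕ | X t ω = x}.Finite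

/-! The proof builds one Lyapunov function that decreases in mean under both laws, so the choice
between them is irrelevant. For a centred step with covariance `M`, second-order expansion shows
that `(K + ‖y‖²) ^ (-α)` with small `α` has negative drift once the top eigenvalue of `M` is less
than half its trace (`exists_inverse_power_drift`). A single covariance can be whitened, with ratio
`1 / d < 1 / 2`. For two, a congruence makes them `1` and `diagonal a`, and shrinking the coordinate
of the largest `a i` balances both; three coordinates are needed for this
(`Matrix.PosDef.exists_balancing_congruence`). The drift is strict at each site, so expected visit
counts are finite and Borel–Cantelli applies (`isTransientProcess_of_drift`). -/

/-! ### Negative drift of an inverse power of the norm -/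

/-- A second-order upper bound for `(1 + u) ^ (-α)` when `u` is small compared with `α`. -/
lemma one_add_rpow_neg_le {α u : ℝ} (hα : 0 < α) (hα' : α ≤ 1 / 2) (hu : |u| ≤ α) :
    (1 + u) ^ (-α) ≤ 1 - α * u + α * (1 / 2 + 6 * α) * u ^ 2 := by
  have hu2 : |u| ≤ 1 / 2 := hu.trans hα'
  have hpos : 0 < 1 + u := by linarith [neg_abs_le u]
  have h0 := abs_nonneg u
  have hlog : |u ^ 2 / 2 - u + Real.log (1 + u)| ≤ 2 * |u| ^ 3 := by
    have h := Real.abs_log_sub_add_sum_range_le (x := -u) (by rw [abs_neg]; linarith) 2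
    have e : ∑ i ∈ Finset.range 2, (-u) ^ (i + 1) / ((i : ℝ) + 1) + Real.log (1 - -u)
        = u ^ 2 / 2 - u + Real.log (1 + u) := by
      rw [Finset.sum_range_succ, Finset.sum_range_one]
      norm_num
      ring
    rw [e, abs_neg] at h
    refine h.trans ?_
    rw [div_le_iff₀ (by linarith)]
    rw [show 2 * |u| ^ 3 * (1 - |u|) = |u| ^ (2 + 1) + |u| ^ 3 * (1 - 2 * |u|) by ring]
    exact le_add_of_nonneg_right (mul_nonneg (pow_nonneg h0 3) (by linarith))
  have hsq : |u| ^ 2 = u ^ 2 := sq_abs u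
  have hcube : |u| ^ 3 ≤ α * u ^ 2 := by
    rw [← hsq, pow_succ']
    exact mul_le_mul_of_nonneg_right hu (by positivity)
  have hcube' : |u| ^ 3 ≤ 1 / 4 * |u| := by
    have : |u| ^ 2 ≤ 1 / 4 := by nlinarith
    nlinarith
  rw [abs_le] at hlog
  have hL : |Real.log (1 + u)| ≤ 2 * |u| := by
    have h1 := neg_abs_le u
    have h2 := le_abs_self u
    have h3 : u ^ 2 ≤ 1 / 2 * |u| := by rw [← hsq]; nlinarith
    rw [abs_le]
    constructor <;> nlinarith [sq_nonneg u]
  have hLsq : Real.log (1 + u) ^ 2 ≤ 4 * u ^ 2 := by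
    rw [← hsq, ← sq_abs (Real.log _)]
    nlinarith [abs_nonneg (Real.log (1 + u))]
  have hw : |Real.log (1 + u) * -α| ≤ 1 := by
    rw [abs_mul, abs_neg, abs_of_pos hα]
    nlinarith [abs_nonneg (Real.log (1 + u))]
  -- With `L = log (1 + u)`, `exp (-α L) ≤ 1 - α L + α² L²`. The coefficient `6 α` is `2 α` from the
  -- cubic error in `L` plus `4 α` from `L² ≤ 4 u²`.
  have hexp := (abs_le.1 (Real.abs_exp_sub_one_sub_id_le hw)).2
  rw [Real.rpow_def_of_pos hpos]
  have h1 : α * (u - u ^ 2 / 2 - 2 * |u| ^ 3) ≤ α * Real.log (1 + u) :=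
    mul_le_mul_of_nonneg_left (by linarith) hα.le
  have h2 : α * |u| ^ 3 ≤ α * (α * u ^ 2) := mul_le_mul_of_nonneg_left hcube hα.le
  have h3 : α ^ 2 * Real.log (1 + u) ^ 2 ≤ α ^ 2 * (4 * u ^ 2) :=
    mul_le_mul_of_nonneg_left hLsq (by positivity)
  nlinarith

/-- If centred steps `v i` of size at most `R` have directional variances at most `l` and total
variance at least `2 * l + ε`, then `(K + ‖·‖²) ^ (-α)` has negative drift everywhere. -/
lemma exists_inverse_power_drift {ι E : Type*} [NormedAddCommGroup E] [InnerProductSpace ℝ E]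
    {R ε : ℝ} (hR : 0 ≤ R) (hε : 0 < ε) :
    ∃ α > (0 : ℝ), ∃ K > (0 : ℝ), ∀ (S : Finset ι) (p : ι → ℝ) (v : ι → E) (l : ℝ) (y : E),
      (∀ i ∈ S, 0 ≤ p i) → ∑ i ∈ S, p i = 1 → ∑ i ∈ S, p i • v i = 0 → (∀ i ∈ S, ‖v i‖ ≤ R) →
      0 ≤ l → ∑ i ∈ S, p i * inner ℝ y (v i) ^ 2 ≤ l * ‖y‖ ^ 2 →
      2 * l + ε ≤ ∑ i ∈ S, p i * ‖v i‖ ^ 2 →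
      ∑ i ∈ S, p i * (K + ‖y + v i‖ ^ 2) ^ (-α) ≤
        (K + ‖y‖ ^ 2) ^ (-α) * (1 - α * ε / (2 * (K + ‖y‖ ^ 2))) := by
  obtain ⟨α, hα, hα', hαε⟩ :
      ∃ α > (0 : ℝ), α ≤ 1 / 2 ∧ α * (7 + 24 * R ^ 2) ≤ ε / 2 := by
    refine ⟨min (1 / 2) (ε / 2 / (7 + 24 * R ^ 2)), by positivity, min_le_left _ _, ?_⟩
    calc _ ≤ ε / 2 / (7 + 24 * R ^ 2) * (7 + 24 * R ^ 2) :=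
          mul_le_mul_of_nonneg_right (min_le_right _ _) (by positivity)
      _ = ε / 2 := div_mul_cancel₀ _ (by positivity)
  -- `A` dominates both `2 R + R²`, which bounds `c i / s`, and the lower-order part `4 R³ + R⁴` of
  -- `c i ^ 2`. Taking `K = (A / α)²` turns `A * s` into at most `α * q`.
  set A := 4 * R ^ 3 + R ^ 4 + 2 * R + R ^ 2 + 1 with hA
  have hA1 : 1 ≤ A := by rw [hA]; linarith [show 0 ≤ 4 * R ^ 3 + R ^ 4 + 2 * R + R ^ 2 by positivity]
  have hK1 : 1 ≤ A / α := by rw [le_div_iff₀ hα]; linarith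
  refine ⟨α, hα, (A / α) ^ 2, by positivity, ?_⟩
  intro S p v l y hp hp1 hv0 hvR hl hvar htr
  set q := (A / α) ^ 2 + ‖y‖ ^ 2 with hq
  have hq0 : 0 < q := by positivity
  obtain ⟨s, hs0, hsq⟩ : ∃ s : ℝ, 0 ≤ s ∧ s ^ 2 = q := ⟨√q, Real.sqrt_nonneg _, Real.sq_sqrt hq0.le⟩
  have hsA : A / α ≤ s := by
    refine (le_abs_self _).trans (abs_le_of_sq_le_sq ?_ hs0)
    rw [hsq, hq]; linarith [sq_nonneg ‖y‖]
  have hys : ‖y‖ ≤ s := by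
    refine (le_abs_self _).trans (abs_le_of_sq_le_sq ?_ hs0)
    rw [hsq, hq]; linarith [sq_nonneg (A / α)]
  have hs1 : 1 ≤ s := hK1.trans hsA
  have hAs : A * s ≤ α * q := by
    rw [div_le_iff₀ hα] at hsA
    rw [← hsq]; nlinarith
  -- `c i` is the increment of `‖y‖²` along the step `v i`.
  set c : ι → ℝ := fun i => 2 * inner ℝ y (v i) + ‖v i‖ ^ 2 with hc
  have hinner : ∀ i ∈ S, |inner ℝ y (v i)| ≤ s * R := fun i hi =>
    (abs_real_inner_le_norm _ _).trans (mul_le_mul hys (hvR i hi) (norm_nonneg _) hs0)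
  have hnsq : ∀ i ∈ S, ‖v i‖ ^ 2 ≤ R ^ 2 := fun i hi => pow_le_pow_left₀ (norm_nonneg _) (hvR i hi) 2
  have hcle : ∀ i ∈ S, |c i / q| ≤ α := by
    intro i hi
    rw [abs_div, abs_of_pos hq0, div_le_iff₀ hq0]
    refine le_trans ?_ hAs
    have h1 := abs_le.1 (hinner i hi)
    have h2 := hnsq i hi
    have h3 := sq_nonneg ‖v i‖
    have h4 : 2 * (s * R) + R ^ 2 ≤ A * s := by
      rw [hA]
      nlinarith [mul_nonneg (sq_nonneg R) (sub_nonneg.2 hs1),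
        show 0 ≤ (4 * R ^ 3 + R ^ 4 + 1) * s by positivity]
    rw [abs_le]; constructor <;> simp only [hc] <;> linarith
  have hfac : ∀ i ∈ S, p i * ((A / α) ^ 2 + ‖y + v i‖ ^ 2) ^ (-α) ≤
      q ^ (-α) * (p i * (1 - α * (c i / q) + α * (1 / 2 + 6 * α) * (c i / q) ^ 2)) := by
    intro i hi
    have e : (A / α) ^ 2 + ‖y + v i‖ ^ 2 = q * (1 + c i / q) := by
      rw [norm_add_sq_real, hq, hc]
      field_simp
      ring
    have h1 : 0 ≤ 1 + c i / q := by linarith [(abs_le.1 (hcle i hi)).1]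
    rw [e, Real.mul_rpow hq0.le h1]
    have := mul_le_mul_of_nonneg_left (one_add_rpow_neg_le hα hα' (hcle i hi))
      (mul_nonneg (Real.rpow_nonneg hq0.le (-α)) (hp i hi))
    linarith
  refine (Finset.sum_le_sum hfac).trans ?_
  rw [← Finset.mul_sum]
  refine mul_le_mul_of_nonneg_left ?_ (Real.rpow_nonneg hq0.le _)
  have hmean : ∑ i ∈ S, p i * inner ℝ y (v i) = 0 := by
    have : inner ℝ y (∑ i ∈ S, p i • v i) = 0 := by rw [hv0, inner_zero_right]
    simpa [inner_sum, inner_smul_right] using this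
  set T := ∑ i ∈ S, p i * ‖v i‖ ^ 2 with hT
  have hc1 : ∑ i ∈ S, p i * c i = T := by
    simp only [hc, mul_add, Finset.sum_add_distrib, mul_left_comm _ (2 : ℝ), ← Finset.mul_sum, hmean]
    rw [mul_zero, zero_add]
  have hTR : T ≤ R ^ 2 := by
    calc T ≤ ∑ i ∈ S, p i * R ^ 2 :=
          Finset.sum_le_sum fun i hi => mul_le_mul_of_nonneg_left (hnsq i hi) (hp i hi)
      _ = R ^ 2 := by rw [← Finset.sum_mul, hp1, one_mul]
  have hc2 : ∑ i ∈ S, p i * c i ^ 2 ≤ (4 * l + α) * q := by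
    have hb : ∀ i ∈ S, p i * c i ^ 2 ≤
        4 * (p i * inner ℝ y (v i) ^ 2) + p i * (4 * s * R ^ 3 + R ^ 4) := by
      intro i hi
      have h1 := (abs_le.1 (hinner i hi)).2
      have h2 := hnsq i hi
      have h3 := sq_nonneg ‖v i‖
      have h4 : inner ℝ y (v i) * ‖v i‖ ^ 2 ≤ s * R * R ^ 2 :=
        mul_le_mul h1 h2 h3 (by positivity)
      have h5 : c i ^ 2 ≤ 4 * inner ℝ y (v i) ^ 2 + (4 * s * R ^ 3 + R ^ 4) := by
        simp only [hc]; nlinarith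
      nlinarith [mul_le_mul_of_nonneg_left h5 (hp i hi)]
    refine (Finset.sum_le_sum hb).trans ?_
    rw [Finset.sum_add_distrib, ← Finset.mul_sum, ← Finset.sum_mul, hp1, one_mul]
    have h1 : l * ‖y‖ ^ 2 ≤ l * q :=
      mul_le_mul_of_nonneg_left (by rw [hq]; linarith [sq_nonneg (A / α)]) hl
    have h2 : 4 * s * R ^ 3 + R ^ 4 ≤ A * s := by
      rw [hA]
      nlinarith [mul_nonneg (show 0 ≤ R ^ 4 by positivity) (sub_nonneg.2 hs1),
        show 0 ≤ (2 * R + R ^ 2 + 1) * s by positivity]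
    linarith
  have hsum : ∑ i ∈ S, p i * (1 - α * (c i / q) + α * (1 / 2 + 6 * α) * (c i / q) ^ 2)
      = 1 - α / q * T + α * (1 / 2 + 6 * α) / q ^ 2 * ∑ i ∈ S, p i * c i ^ 2 := by
    have e : 1 - α / q * T + α * (1 / 2 + 6 * α) / q ^ 2 * ∑ i ∈ S, p i * c i ^ 2 =
        ∑ i ∈ S, p i - α / q * ∑ i ∈ S, p i * c i +
          α * (1 / 2 + 6 * α) / q ^ 2 * ∑ i ∈ S, p i * c i ^ 2 := by rw [hc1, hp1]
    rw [e, Finset.mul_sum, Finset.mul_sum, ← Finset.sum_sub_distrib, ← Finset.sum_add_distrib]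
    refine Finset.sum_congr rfl fun i _ => ?_
    field_simp
  rw [hsum]
  have h1 : α * (1 / 2 + 6 * α) / q ^ 2 * ∑ i ∈ S, p i * c i ^ 2 ≤
      α / q * ((1 / 2 + 6 * α) * (4 * l + α)) := by
    calc _ ≤ α * (1 / 2 + 6 * α) / q ^ 2 * ((4 * l + α) * q) :=
          mul_le_mul_of_nonneg_left hc2 (by positivity)
      _ = _ := by field_simp
  -- The leading terms are `2 * l - T ≤ -ε`; the choice of `α` keeps the remainder below `ε / 2`.
  have h2 : (1 / 2 + 6 * α) * (4 * l + α) - T ≤ -(ε / 2) := by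
    have hlR : l ≤ R ^ 2 := by linarith only [htr, hTR, hl, hε]
    have hαl : α * l ≤ α * R ^ 2 := mul_le_mul_of_nonneg_left hlR hα.le
    have hαα : α * α ≤ α * (1 / 2) := mul_le_mul_of_nonneg_left hα' hα.le
    linarith only [htr, hαε, hαl, hαα, hα]
  have h3 := mul_le_mul_of_nonneg_left h2 (show 0 ≤ α / q by positivity)
  have h4 : α * ε / (2 * q) = α / q * (ε / 2) := by field_simp
  rw [h4]
  linarith

/-! ### Balancing two positive definite matrices -/

open Matrix in
lemma Matrix.IsHermitian.exists_orthogonal_conj_eq_diagonal {n : Type*} [Fintype n] [DecidableEq n]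
    {A : Matrix n n ℝ} (hA : A.IsHermitian) :
    ∃ U : Matrix n n ℝ, U * Uᵀ = 1 ∧ U * A * Uᵀ = diagonal hA.eigenvalues := by
  refine ⟨star (hA.eigenvectorUnitary : Matrix n n ℝ), ?_, ?_⟩
  · have := Unitary.coe_star_mul_self hA.eigenvectorUnitary
    simpa [Matrix.star_eq_conjTranspose] using this
  · have := hA.conjStarAlgAut_star_eigenvectorUnitary
    rw [Unitary.conjStarAlgAut_apply] at this
    simpa [Matrix.star_eq_conjTranspose, Function.comp_def] using this

open Matrix in
/-- Two positive definite real matrices are simultaneously diagonalised by a congruence. -/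
lemma Matrix.PosDef.exists_simultaneous_congruence {n : Type*} [Fintype n] [DecidableEq n]
    {A B : Matrix n n ℝ} (hA : A.PosDef) (hB : B.PosDef) :
    ∃ (T : Matrix n n ℝ) (a : n → ℝ), (∀ i, 0 < a i) ∧ T * A * Tᵀ = 1 ∧ T * B * Tᵀ = diagonal a := by
  obtain ⟨U, hU, hUA⟩ := hA.isHermitian.exists_orthogonal_conj_eq_diagonal
  set e := hA.isHermitian.eigenvalues
  have he : ∀ i, 0 < e i := hA.eigenvalues_pos
  set D : Matrix n n ℝ := diagonal fun i => (√(e i))⁻¹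
  have hW : (D * U) * A * (D * U)ᵀ = 1 := by
    have : (D * U) * A * (D * U)ᵀ = D * (U * A * Uᵀ) * D := by
      simp [D, transpose_mul, Matrix.mul_assoc]
    rw [this, hUA, diagonal_mul_diagonal, diagonal_mul_diagonal, ← diagonal_one]
    congr 1
    ext i
    have := Real.mul_self_sqrt (he i).le
    have h0 : √(e i) ≠ 0 := (Real.sqrt_pos.2 (he i)).ne'
    field_simp
    nlinarith
  set W := D * U
  have hunit : IsUnit W := by
    rw [Matrix.isUnit_iff_isUnit_det]
    refine IsUnit.of_mul_eq_one (A * Wᵀ).det ?_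
    rw [← det_mul, ← Matrix.mul_assoc, hW, det_one]
  have hC : (W * B * Wᵀ).PosDef := by
    have := (Matrix.IsUnit.posDef_star_right_conjugate_iff (x := B) hunit).2 hB
    simpa [Matrix.star_eq_conjTranspose] using this
  -- `W` whitens `A`; an orthogonal `V` then diagonalises the image of `B` without disturbing the
  -- identity.
  obtain ⟨V, hV, hVC⟩ := hC.isHermitian.exists_orthogonal_conj_eq_diagonal
  refine ⟨V * W, _, hC.eigenvalues_pos, ?_, ?_⟩
  · calc _ = V * (W * A * Wᵀ) * Vᵀ := by simp [transpose_mul, Matrix.mul_assoc]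
      _ = 1 := by rw [hW, Matrix.mul_one, hV]
  · rw [← hVC]; simp [transpose_mul, Matrix.mul_assoc]

/-- Positive weights under which neither `b` nor `a * b` has an entry dominating its sum. -/
lemma exists_balancing_weights {d : ℕ} (hd : 3 ≤ d) (a : Fin d → ℝ) (ha : ∀ i, 0 < a i) :
    ∃ (b : Fin d → ℝ) (l : ℝ), (∀ i, 0 < b i) ∧ 0 < l ∧ (∀ i, b i ≤ 1) ∧ 2 < ∑ i, b i ∧
      (∀ i, a i * b i ≤ l) ∧ 2 * l < ∑ i, a i * b i := by
  classical
  have : Nonempty (Fin d) := ⟨⟨0, by omega⟩⟩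
  obtain ⟨p, hp⟩ := Finite.exists_max a
  have hcard : (Finset.univ : Finset (Fin d)).card = d := by simp
  have hne : (Finset.univ.erase p : Finset (Fin d)).Nonempty := by
    rw [← Finset.card_pos, Finset.card_erase_of_mem (Finset.mem_univ _), hcard]; omega
  obtain ⟨q, hq, hqmax⟩ := Finset.exists_max_image _ a hne
  have hqp : q ≠ p := Finset.ne_of_mem_erase hq
  have hne' : ((Finset.univ.erase p).erase q : Finset (Fin d)).Nonempty := by
    rw [← Finset.card_pos, Finset.card_erase_of_mem hq,
      Finset.card_erase_of_mem (Finset.mem_univ _), hcard]; omega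
  obtain ⟨r, hr⟩ := hne'
  have hrq : r ≠ q := Finset.ne_of_mem_erase hr
  have hrp : r ≠ p := Finset.ne_of_mem_erase (Finset.mem_of_mem_erase hr)
  -- Lowering the largest entry `a p` to the second largest `a q` makes `a q` the maximum of `a *
  -- b`, attained twice; the third index `r` makes the sum strictly exceed `2 * a q`.
  set b : Fin d → ℝ := fun i => if i = p then a q / a p else 1
  have hbp : b p = a q / a p := if_pos rfl
  have hb1 : ∀ i, i ≠ p → b i = 1 := fun i hi => if_neg hi
  have hb0 : ∀ i, 0 < b i := by
    intro i
    by_cases hi : i = p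
    · rw [hi, hbp]; exact div_pos (ha q) (ha p)
    · rw [hb1 i hi]; exact one_pos
  have hsum : ∀ c : Fin d → ℝ, (∀ i, 0 < c i) → c p + c q + c r ≤ ∑ i, c i := by
    intro c hc
    have := Finset.sum_le_univ_sum_of_nonneg (s := {p, q, r}) (f := c) fun i => (hc i).le
    rwa [Finset.sum_insert (by simp [hqp.symm, hrp.symm]), Finset.sum_pair hrq.symm,
      ← add_assoc] at this
  have habp : a p * b p = a q := by rw [hbp, mul_div_cancel₀ _ (ha p).ne']
  refine ⟨b, a q, hb0, ha q, ?_, ?_, ?_, ?_⟩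
  · intro i
    by_cases hi : i = p
    · rw [hi, hbp, div_le_one (ha p)]; exact hp q
    · rw [hb1 i hi]
  · have := hsum b hb0
    rw [hb1 q hqp, hb1 r hrp] at this
    linarith [hb0 p]
  · intro i
    by_cases hi : i = p
    · rw [hi, habp]
    · rw [hb1 i hi, mul_one]; exact hqmax i (Finset.mem_erase.2 ⟨hi, Finset.mem_univ _⟩)
  · have := hsum (fun i => a i * b i) fun i => mul_pos (ha i) (hb0 i)
    rw [habp, hb1 q hqp, hb1 r hrp] at this
    linarith [ha r]

open Matrix in
/-- Two positive definite matrices in dimension at least three can be brought by one congruence to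
diagonal form with no diagonal entry reaching half of the trace. -/
lemma Matrix.PosDef.exists_balancing_congruence {d : ℕ} (hd : 3 ≤ d) {A B : Matrix (Fin d) (Fin d) ℝ}
    (hA : A.PosDef) (hB : B.PosDef) :
    ∃ (T : Matrix (Fin d) (Fin d) ℝ) (a b : Fin d → ℝ) (k l : ℝ), 0 < k ∧ 0 < l ∧
      T * A * Tᵀ = diagonal a ∧ T * B * Tᵀ = diagonal b ∧
      (∀ i, a i ≤ k) ∧ (∀ i, b i ≤ l) ∧ 2 * k < ∑ i, a i ∧ 2 * l < ∑ i, b i := by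
  obtain ⟨T, a, ha, hTA, hTB⟩ := hA.exists_simultaneous_congruence hB
  obtain ⟨b, l, hb, hl, hb1, hb2, hab1, hab2⟩ := exists_balancing_weights hd a ha
  set D : Matrix (Fin d) (Fin d) ℝ := diagonal fun i => √(b i)
  have hD : ∀ M : Matrix (Fin d) (Fin d) ℝ, (D * T) * M * (D * T)ᵀ = D * (T * M * Tᵀ) * D := by
    intro M; simp [D, transpose_mul, Matrix.mul_assoc]
  refine ⟨D * T, b, fun i => a i * b i, 1, l, one_pos, hl, ?_, ?_, hb1, hab1, by simpa using hb2,
    hab2⟩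
  · rw [hD, hTA, Matrix.mul_one, diagonal_mul_diagonal]
    congr 1; ext i; exact Real.mul_self_sqrt (hb i).le
  · rw [hD, hTB, diagonal_mul_diagonal, diagonal_mul_diagonal]
    congr 1; ext i
    linear_combination a i * Real.mul_self_sqrt (hb i).le

/-! ### Second-moment matrices -/

open Matrix in
/-- The second-moment matrix of a finite system of weighted vectors. -/
noncomputable def secondMoment {ι n : Type*} (S : Finset ι) (p : ι → ℝ) (v : ι → n → ℝ) :
    Matrix n n ℝ :=
  ∑ z ∈ S, p z • vecMulVec (v z) (v z)

open Matrix in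
lemma mul_secondMoment_mul_transpose {ι m n : Type*} [Fintype n] (S : Finset ι) (p : ι → ℝ)
    (v : ι → n → ℝ) (T : Matrix m n ℝ) :
    T * secondMoment S p v * Tᵀ = secondMoment S p fun z => T *ᵥ v z := by
  simp [secondMoment, Matrix.mul_sum, Matrix.sum_mul, mul_vecMulVec, vecMulVec_mul,
    vecMul_transpose]

open Matrix in
lemma dotProduct_secondMoment_mulVec {ι n : Type*} [Fintype n] (S : Finset ι) (p : ι → ℝ)
    (v : ι → n → ℝ) (x : n → ℝ) :
    x ⬝ᵥ (secondMoment S p v *ᵥ x) = ∑ z ∈ S, p z * (x ⬝ᵥ v z) ^ 2 := by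
  simp only [secondMoment, Matrix.sum_mulVec, Matrix.smul_mulVec, dotProduct_sum, dotProduct_smul,
    vecMulVec_mulVec, smul_eq_mul]
  refine Finset.sum_congr rfl fun z _ => ?_
  simp [dotProduct_comm, pow_two]

open Matrix in
lemma trace_secondMoment {ι n : Type*} [Fintype n] (S : Finset ι) (p : ι → ℝ)
    (v : ι → n → ℝ) : (secondMoment S p v).trace = ∑ z ∈ S, p z * (v z ⬝ᵥ v z) := by
  simp [secondMoment, trace_sum, trace_smul, trace_vecMulVec]

-- If the quadratic form vanishes at `x`, then `x` is orthogonal to a spanning set, hence to itself.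
open Matrix in
lemma posDef_secondMoment {ι n : Type*} [Fintype n] (S : Finset ι) (p : ι → ℝ)
    (v : ι → n → ℝ) (hp : ∀ z ∈ S, 0 ≤ p z)
    (hspan : Submodule.span ℝ (v '' {z | z ∈ S ∧ p z ≠ 0}) = ⊤) :
    (secondMoment S p v).PosDef := by
  refine .of_dotProduct_mulVec_pos ?_ fun x hx => ?_
  · ext i j
    simp [secondMoment, Matrix.sum_apply, vecMulVec_apply, mul_comm]
  · rw [star_trivial, dotProduct_secondMoment_mulVec]
    have hnn : ∀ z ∈ S, 0 ≤ p z * (x ⬝ᵥ v z) ^ 2 := fun z hz => mul_nonneg (hp z hz) (sq_nonneg _)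
    refine (Finset.sum_nonneg hnn).lt_of_ne' fun h0 => hx ?_
    rw [Finset.sum_eq_zero_iff_of_nonneg hnn] at h0
    have hle : Submodule.span ℝ (v '' {z | z ∈ S ∧ p z ≠ 0}) ≤
        LinearMap.ker (dotProductBilin ℝ ℝ x) := by
      rw [Submodule.span_le]
      rintro _ ⟨z, ⟨hz, hpz⟩, rfl⟩
      simpa [hpz] using h0 z hz
    rw [hspan] at hle
    exact dotProduct_self_eq_zero.1 (hle (Submodule.mem_top (x := x)))

/-! ### From drift to transience -/

/-- A bounded nonnegative function of the process whose expectation decreases at each step by the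
expectation of a positive function forces transience. -/
lemma isTransientProcess_of_drift {d : ℕ} {Ω : Type*} [mΩ : MeasurableSpace Ω] {P : Measure Ω}
    [IsProbabilityMeasure P] {ℱ : Filtration ℕ mΩ} {X : ℕ → Ω → (Fin d → ℤ)} (hX : Adapted ℱ X)
    (S : Finset (Fin d → ℤ)) {f g : (Fin d → ℤ) → ℝ} {C : ℝ} (hf0 : ∀ x, 0 ≤ f x)
    (hfC : ∀ x, f x ≤ C) (hg0 : ∀ x, 0 < g x) (hgf : ∀ x, g x ≤ f x)
    (hS : ∀ t, ∀ᵐ ω ∂P, X (t + 1) ω - X t ω ∈ S)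
    (hdrift : ∀ t, ∀ᵐ ω ∂P, ∀ x, ∑ z ∈ S, f (x + z) *
      (P[({ω' | X (t + 1) ω' - X t ω' = z} : Set Ω).indicator (fun _ => (1 : ℝ)) | ℱ t]) ω
        ≤ f x - g x) :
    IsTransientProcess P X := by
  have hmeas : ∀ t, Measurable (X t) := fun t => (hX t).mono (ℱ.le t) le_rfl
  have hint : ∀ (h : (Fin d → ℤ) → ℝ), (∀ x, 0 ≤ h x) → (∀ x, h x ≤ C) → ∀ t z,
      Integrable (fun ω => h (X t ω + z)) P := fun h h0 hC t z =>
    Integrable.of_bound (((measurable_of_countable h).comp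
      ((hmeas t).add_const z)).aestronglyMeasurable) C
      (.of_forall fun ω => by simpa [abs_of_nonneg (h0 _)] using hC _)
  have hfint : ∀ t, Integrable (fun ω => f (X t ω)) P := fun t => by
    simpa using hint f hf0 hfC t 0
  have hgint : ∀ t, Integrable (fun ω => g (X t ω)) P := fun t => by
    simpa using hint g (fun x => (hg0 x).le) (fun x => (hgf x).trans (hfC x)) t 0
  have hstep : ∀ t, ∫ ω, f (X (t + 1) ω) ∂P ≤ ∫ ω, f (X t ω) ∂P - ∫ ω, g (X t ω) ∂P := by
    intro t
    set A : (Fin d → ℤ) → Set Ω := fun z => {ω' | X (t + 1) ω' - X t ω' = z} with hA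
    have hAm : ∀ z, MeasurableSet (A z) := fun z =>
      ((hmeas (t + 1)).sub (hmeas t)) (measurableSet_singleton z)
    set F : (Fin d → ℤ) → Ω → ℝ := fun z ω => f (X t ω + z)
    set J : (Fin d → ℤ) → Ω → ℝ := fun z => (A z).indicator (fun _ => (1 : ℝ))
    have hJint : ∀ z, Integrable (J z) P := fun z => (integrable_const 1).indicator (hAm z)
    have hFm : ∀ z, StronglyMeasurable[ℱ t] (F z) := fun z =>
      ((measurable_of_countable fun x => f (x + z)).comp (hX t)).stronglyMeasurable
    have hFJ : ∀ z, Integrable (F z * J z) P := fun z => by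
      have : F z * J z = (A z).indicator (F z) := by
        ext ω; by_cases h : ω ∈ A z <;> simp [J, h]
      rw [this]
      exact (hint f hf0 hfC t z).indicator (hAm z)
    -- For fixed `z`, `f (X t + z)` is known at time `t`, so it leaves the conditional expectation.
    have hpull : ∀ z, P[F z * J z | ℱ t] =ᵐ[P] F z * P[J z | ℱ t] := fun z =>
      condExp_mul_of_stronglyMeasurable_left (hFm z) (hFJ z) (hJint z)
    have hFJ' : ∀ z, Integrable (F z * P[J z | ℱ t]) P := fun z =>
      integrable_condExp.congr (hpull z)
    calc ∫ ω, f (X (t + 1) ω) ∂P = ∫ ω, ∑ z ∈ S, (F z * J z) ω ∂P := by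
          refine integral_congr_ae ?_
          filter_upwards [hS t] with ω hω
          rw [Finset.sum_eq_single_of_mem _ hω]
          · simp [F, J, A]
          · intro z _ hz
            have : ω ∉ A z := fun h => hz h.symm
            simp [J, this]
      _ = ∑ z ∈ S, ∫ ω, (F z * J z) ω ∂P := integral_finsetSum _ fun z _ => hFJ z
      _ = ∑ z ∈ S, ∫ ω, (F z * P[J z | ℱ t]) ω ∂P := Finset.sum_congr rfl fun z _ => by
          rw [← integral_condExp (ℱ.le t), integral_congr_ae (hpull z)]
      _ = ∫ ω, ∑ z ∈ S, (F z * P[J z | ℱ t]) ω ∂P :=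
          (integral_finsetSum _ fun z _ => hFJ' z).symm
      _ ≤ ∫ ω, f (X t ω) - g (X t ω) ∂P := by
          refine integral_mono_ae (integrable_finsetSum _ fun z _ => hFJ' z)
            ((hfint t).sub (hgint t)) ?_
          filter_upwards [hdrift t] with ω hω using hω (X t ω)
      _ = _ := integral_sub (hfint t) (hgint t)
  have hpart : ∀ n, ∑ t ∈ Finset.range n, ∫ ω, g (X t ω) ∂P ≤ C := by
    intro n
    have h1 : ∑ t ∈ Finset.range n, ∫ ω, g (X t ω) ∂P ≤
        ∫ ω, f (X 0 ω) ∂P - ∫ ω, f (X n ω) ∂P := by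
      rw [← Finset.sum_range_sub' fun t => ∫ ω, f (X t ω) ∂P]
      exact Finset.sum_le_sum fun t _ => by linarith [hstep t]
    have h2 : ∫ ω, f (X 0 ω) ∂P ≤ C := by
      simpa using integral_mono (hfint 0) (integrable_const C) fun ω => hfC _
    have h3 : 0 ≤ ∫ ω, f (X n ω) ∂P := integral_nonneg fun ω => hf0 _
    linarith
  -- Borel–Cantelli at each site: `P (X t = x)` is at most `E[g (X t)] / g x`, which is summable by
  -- telescoping.
  refine ae_all_iff.2 fun x => ae_finite_setOfPred_mem (s := fun t => {ω | X t ω = x}) ?_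
  have hle : ∀ t, P.real {ω | X t ω = x} ≤ (g x)⁻¹ * ∫ ω, g (X t ω) ∂P := by
    intro t
    have hm : MeasurableSet {ω | X t ω = x} := hmeas t (measurableSet_singleton x)
    have h1 : ∫ ω, {ω | X t ω = x}.indicator (fun _ => g x) ω ∂P ≤ ∫ ω, g (X t ω) ∂P := by
      refine integral_mono ((integrable_const _).indicator hm) (hgint t) fun ω => ?_
      by_cases h : X t ω = x
      · simp [h]
      · simpa [h] using (hg0 _).le
    rw [integral_indicator_const _ hm, smul_eq_mul] at h1
    rw [← div_eq_inv_mul, le_div_iff₀ (hg0 x)]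
    exact h1
  have hsum : Summable fun t => P.real {ω | X t ω = x} :=
    Summable.of_nonneg_of_le (fun _ => measureReal_nonneg) hle
      ((summable_of_sum_range_le (fun t => integral_nonneg fun ω => (hg0 _).le) hpart).mul_left _)
  have := hsum.tsum_ofReal_ne_top
  simpa [Measure.real] using this

/-! ### Step laws and the main theorem -/

lemma IsStepLaw.exists_finset {d : ℕ} {μ : Measure (Fin d → ℤ)} (h : IsStepLaw μ) :
    ∃ S : Finset (Fin d → ℤ), ∀ z, z ∈ S ↔ μ {z} ≠ 0 := by
  have hfin : (latticeSupport μ).Finite := by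
    have := Metric.isCompact_of_isClosed_isBounded (isClosed_discrete _) h.bounded_support
    exact this.finite_of_discrete
  exact ⟨hfin.toFinset, fun z => by simp [latticeSupport]⟩

/-- `S` may exceed the support, so that both laws can be summed over one common finite set. -/
lemma IsStepLaw.sum_measureReal {d : ℕ} {μ : Measure (Fin d → ℤ)} (h : IsStepLaw μ)
    {S : Finset (Fin d → ℤ)} (hS : ∀ z, μ {z} ≠ 0 → z ∈ S) :
    ∑ z ∈ S, μ.real {z} = 1 ∧ ∑ z ∈ S, μ.real {z} • latticeToReal z = 0 := by
  have := h.isProbabilityMeasure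
  have hae : ∀ᵐ z ∂μ, z ∈ (S : Set (Fin d → ℤ)) := by
    rw [ae_iff_of_countable]
    exact fun z hz => hS z hz
  have hrestr : μ.restrict S = μ := Measure.restrict_eq_self_of_ae_mem hae
  constructor
  · rw [sum_measureReal_singleton, measureReal_def, (mem_ae_iff_prob_eq_one S.measurableSet).1 hae, ENNReal.toReal_one]
  · rw [← h.mean_zero]
    conv_rhs => rw [← hrestr]
    rw [setIntegral_finset]
    exact IntegrableOn.finset

open Matrix in
lemma IsStepLaw.posDef_secondMoment {d : ℕ} {μ : Measure (Fin d → ℤ)} (h : IsStepLaw μ)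
    {S : Finset (Fin d → ℤ)} (hS : ∀ z, μ {z} ≠ 0 → z ∈ S) :
    (secondMoment S (fun z => μ.real {z}) latticeToReal).PosDef := by
  have := h.isProbabilityMeasure
  refine _root_.posDef_secondMoment _ _ _ (fun _ _ => measureReal_nonneg) ?_
  rw [← h.full_dimension]
  congr 2
  ext z
  have hz : μ.real {z} ≠ 0 ↔ μ {z} ≠ 0 := measureReal_ne_zero_iff
  exact ⟨fun h' => hz.1 h'.2, fun h' => ⟨hS z h', hz.2 h'⟩⟩

open Matrix in
/-- The drift of the step law `μ` in the coordinates given by `T`, where its second-moment matrix is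
diagonal with entries at most `l` and trace at least `2 * l + ε`. -/
lemma IsStepLaw.drift {d : ℕ} {μ : Measure (Fin d → ℤ)} (h : IsStepLaw μ)
    {S : Finset (Fin d → ℤ)} (hS : ∀ z, μ {z} ≠ 0 → z ∈ S) {T : Matrix (Fin d) (Fin d) ℝ}
    {a : Fin d → ℝ} {l ε : ℝ}
    (hT : T * secondMoment S (fun z => μ.real {z}) latticeToReal * Tᵀ = diagonal a)
    (hal : ∀ i, a i ≤ l) (hε : 2 * l + ε ≤ ∑ i, a i) (y : EuclideanSpace ℝ (Fin d)) :
    let v : (Fin d → ℤ) → EuclideanSpace ℝ (Fin d) := fun z => WithLp.toLp 2 (T *ᵥ latticeToReal z)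
    ∑ z ∈ S, μ.real {z} • v z = 0 ∧
      ∑ z ∈ S, μ.real {z} * inner ℝ y (v z) ^ 2 ≤ l * ‖y‖ ^ 2 ∧
      2 * l + ε ≤ ∑ z ∈ S, μ.real {z} * ‖v z‖ ^ 2 := by
  intro v
  rw [mul_secondMoment_mul_transpose] at hT
  have hinner : ∀ z, inner ℝ y (v z) = y.ofLp ⬝ᵥ (T *ᵥ latticeToReal z) := fun z => by
    simp [v, EuclideanSpace.inner_eq_star_dotProduct, dotProduct_comm]
  refine ⟨?_, ?_, ?_⟩
  · have h0 := congrArg (fun w => WithLp.toLp 2 (T *ᵥ w)) (h.sum_measureReal hS).2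
    simpa [Matrix.mulVec_sum, mulVec_smul, v, WithLp.toLp_sum] using h0
  · simp only [hinner]
    rw [← dotProduct_secondMoment_mulVec S _ (fun z => T *ᵥ latticeToReal z), hT,
      EuclideanSpace.real_norm_sq_eq, Finset.mul_sum]
    refine Finset.sum_le_sum fun i _ => ?_
    rw [mulVec_diagonal]
    nlinarith [mul_le_mul_of_nonneg_right (hal i) (sq_nonneg (y i))]
  · have htr := trace_secondMoment S (fun z => μ.real {z}) (fun z => T *ᵥ latticeToReal z)
    rw [hT, trace_diagonal] at htr
    rw [htr] at hε
    refine hε.trans_eq (Finset.sum_congr rfl fun z _ => ?_)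
    rw [EuclideanSpace.real_norm_sq_eq]
    simp [v, dotProduct, pow_two]

theorem mainTheorem7 (d : ℕ) (hd : 3 ≤ d) (μ₁ μ₂ : Measure (Fin d → ℤ))
    (hμ₁ : IsStepLaw μ₁) (hμ₂ : IsStepLaw μ₂)
    {Ω : Type*} [mΩ : MeasurableSpace Ω] (P : Measure Ω) [IsProbabilityMeasure P]
    (ℱ : Filtration ℕ mΩ) (X : ℕ → Ω → (Fin d → ℤ))
    (hX : Adapted ℱ X)
    (hstep : ∀ t, ∀ᵐ ω ∂P,
      StepHasCondLawAt P (ℱ t) X t μ₁ ω ∨ StepHasCondLawAt P (ℱ t) X t μ₂ ω) :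
    IsTransientProcess P X := by
  classical
  obtain ⟨S₁, hS₁⟩ := hμ₁.exists_finset
  obtain ⟨S₂, hS₂⟩ := hμ₂.exists_finset
  set S := S₁ ∪ S₂
  have h₁ : ∀ z, μ₁ {z} ≠ 0 → z ∈ S := fun z hz => Finset.mem_union_left _ ((hS₁ z).2 hz)
  have h₂ : ∀ z, μ₂ {z} ≠ 0 → z ∈ S := fun z hz => Finset.mem_union_right _ ((hS₂ z).2 hz)
  obtain ⟨T, a, b, k, l, hk, hl, hTa, hTb, hak, hbl, hka, hlb⟩ :=
    (hμ₁.posDef_secondMoment h₁).exists_balancing_congruence hd (hμ₂.posDef_secondMoment h₂)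
  obtain ⟨ε, hε, hεa, hεb⟩ : ∃ ε > 0, 2 * k + ε ≤ ∑ i, a i ∧ 2 * l + ε ≤ ∑ i, b i :=
    ⟨min (∑ i, a i - 2 * k) (∑ i, b i - 2 * l), lt_min (by linarith) (by linarith),
      by linarith [min_le_left (∑ i, a i - 2 * k) (∑ i, b i - 2 * l)],
      by linarith [min_le_right (∑ i, a i - 2 * k) (∑ i, b i - 2 * l)]⟩
  set v : (Fin d → ℤ) → EuclideanSpace ℝ (Fin d) :=
    fun z => WithLp.toLp 2 (T.mulVec (latticeToReal z)) with hv
  have hvadd : ∀ x z, v (x + z) = v x + v z := fun x z => by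
    have : latticeToReal (x + z) = latticeToReal x + latticeToReal z := by
      ext i; simp [latticeToReal]
    simp [hv, this, Matrix.mulVec_add]
  obtain ⟨R, hR, hvR⟩ : ∃ R : ℝ, 0 ≤ R ∧ ∀ z ∈ S, ‖v z‖ ≤ R :=
    ⟨∑ z ∈ S, ‖v z‖, Finset.sum_nonneg fun _ _ => norm_nonneg _, fun z hz =>
      Finset.single_le_sum (f := fun z => ‖v z‖) (fun _ _ => norm_nonneg _) hz⟩
  obtain ⟨α, hα, K, hK, hdrift⟩ := exists_inverse_power_drift (ι := Fin d → ℤ)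
    (E := EuclideanSpace ℝ (Fin d)) hR hε
  set f : (Fin d → ℤ) → ℝ := fun x => (K + ‖v x‖ ^ 2) ^ (-α)
  set g : (Fin d → ℤ) → ℝ := fun x => f x * (α * ε / (2 * (K + ‖v x‖ ^ 2)))
  have hf0 : ∀ x, 0 ≤ f x := fun x => by positivity
  have hg0 : ∀ x, 0 < g x := fun x => by positivity
  have hlaw₁ : ∀ x, ∑ z ∈ S, f (x + z) * μ₁.real {z} ≤ f x - g x := fun x => by
    obtain ⟨h0, hvar, htr⟩ := hμ₁.drift h₁ hTa hak hεa (v x)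
    have := hdrift S (fun z => μ₁.real {z}) v k (v x) (fun _ _ => measureReal_nonneg)
      (hμ₁.sum_measureReal h₁).1 h0 hvR hk.le hvar htr
    simp only [f, g, hvadd, mul_comm _ (μ₁.real _)]
    linarith
  have hlaw₂ : ∀ x, ∑ z ∈ S, f (x + z) * μ₂.real {z} ≤ f x - g x := fun x => by
    obtain ⟨h0, hvar, htr⟩ := hμ₂.drift h₂ hTb hbl hεb (v x)
    have := hdrift S (fun z => μ₂.real {z}) v l (v x) (fun _ _ => measureReal_nonneg)
      (hμ₂.sum_measureReal h₂).1 h0 hvR hl.le hvar htr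
    simp only [f, g, hvadd, mul_comm _ (μ₂.real _)]
    linarith
  have hgf : ∀ x, g x ≤ f x := fun x => by
    have : 0 ≤ ∑ z ∈ S, f (x + z) * μ₁.real {z} :=
      Finset.sum_nonneg fun z _ => mul_nonneg (hf0 _) measureReal_nonneg
    linarith [hlaw₁ x]
  have hfC : ∀ x, f x ≤ K ^ (-α) := fun x =>
    Real.rpow_le_rpow_of_nonpos hK (by linarith [sq_nonneg ‖v x‖]) (by linarith)
  refine isTransientProcess_of_drift hX S hf0 hfC hg0 hgf (fun t => ?_) fun t => ?_
  · have hmeas : ∀ t, Measurable (X t) := fun t => (hX t).mono (ℱ.le t) le_rfl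
    -- Integrating the conditional probability of a step outside `S`, which is zero under either
    -- law, shows that such a step is null.
    have hnull : ∀ z, ∀ᵐ ω ∂P, z ∉ S → X (t + 1) ω - X t ω ≠ z := fun z => by
      by_cases hz : z ∈ S
      · exact .of_forall fun _ h => absurd hz h
      have hm : MeasurableSet {ω | X (t + 1) ω - X t ω = z} :=
        ((hmeas (t + 1)).sub (hmeas t)) (measurableSet_singleton z)
      have h0 : P.real {ω | X (t + 1) ω - X t ω = z} = 0 := by
        rw [← integral_indicator_one hm]
        change ∫ ω, ({ω | X (t + 1) ω - X t ω = z} : Set Ω).indicator (fun _ => (1 : ℝ)) ω ∂P = 0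
        rw [← integral_condExp (ℱ.le t)]
        refine integral_eq_zero_of_ae ?_
        filter_upwards [hstep t] with ω hω
        rcases hω with hω | hω
        · rw [hω z, measureReal_def, not_not.1 (mt (h₁ z) hz)]; rfl
        · rw [hω z, measureReal_def, not_not.1 (mt (h₂ z) hz)]; rfl
      rw [measureReal_eq_zero_iff, measure_eq_zero_iff_ae_notMem] at h0
      filter_upwards [h0] with ω hω _ using hω
    filter_upwards [ae_all_iff.2 hnull] with ω hω
    by_contra hc
    exact hω _ hc rfl
  · filter_upwards [hstep t] with ω hω x
    rcases hω with hω | hω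
    · simpa only [hω _] using hlaw₁ x
    · simpa only [hω _] using hlaw₂ x
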